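/- Tensors of order $D$ are elements of $\mathbb{R}^{n_1\times\dots\times n_D}$ with the Frobenius norm; $(U_1,\dots,U_D)\cdot\mathcal{C}$ denotes multilinear multiplication, and $\mathcal{X}_{(d)}$ the $d$th unfolding of $\mathcal{X}$. A *Tucker core structure* is a smooth embedded submanifold $\mathcal{M}\subseteq\mathbb{R}^{l_1\times\dots\times l_D}$ all of whose elements have multilinear rank $(l_1,\dots,l_D)$ and which is invariant under the action of $\mathrm{GL}(l_1)\times\dots\times\mathrm{GL}(l_D)$. The *$\mathcal{M}$-structured Tucker manifold* is $$\mathcal{M}^{n_1,\dots,n_D}=\{(U_1,\dots,U_D)\cdot\mathcal{C} : \mathcal{C}\in\mathcal{M},\ U_d\in\mathbb{R}^{n_d\times l_d},\ \operatorname{rank}U_d=l_d\text{ for all }d\}.$$ Let $\mathcal{M}_r\subseteq\mathbb{R}^{l_1^r\times\dots\times l_D^r}$, $r=1,\dots,R$, be Tucker core structures. A *structured block term decomposition* (SBTD) is a sum $\mathcal{A}_1+\dots+\mathcal{A}_R$ with $\mathcal{A}_r\in\mathcal{M}_r^{n_1,\dots,n_D}$ for each $r$. Let $\Sigma:\mathcal{M}_1^{n_1,\dots,n_D}\times\dots\times\mathcal{M}_R^{n_1,\dots,n_D}\to\mathbb{R}^{n_1\times\dots\times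 n_D}$ be the addition map and $a=(\mathcal{A}_1,\dots,\mathcal{A}_R)$. If $\Sigma$ restricts to a homeomorphism from some neighbourhood $N$ of $a$ in its domain onto the image $\Sigma(N)$, with inverse $\Sigma_a^{-1}:\Sigma(N)\to N$, the *condition number* is $$\kappa^{\mathrm{SBTD}}(\mathcal{A}_1,\dots,\mathcal{A}_R)=\lim_{\delta\to0}\ \sup_{\substack{\widetilde{\mathcal{A}}\in\Sigma(N),\ \widetilde{\mathcal{A}}\neq\Sigma(a)\\ \|\Sigma(a)-\widetilde{\mathcal{A}}\|\le\delta}}\ \frac{\|a-\Sigma_a^{-1}(\widetilde{\mathcal{A}})\|}{\|\Sigma(a)-\widetilde{\mathcal{A}}\|}$$ (with the product Euclidean norm in the numerator; the value does not depend on $N$), and otherwise $\kappa^{\mathrm{SBTD}}=\infty$. A decomposition $\mathcal{X}=(U_1,\dots,U_D)\cdot\mathcal{C}$ with $U_d\in\mathbb{R}^{n_d\times l_d}$ is in *(compact) HOSVD form* if for every $d$ the columns of $U_d$ are an orthonormal system of left singular vectors of $\mathcal{X}_{(d)}$ for all its nonzero singular values, that is, $\mathcal{X}_{(d)}=U_d\,\mathrm{diag}(\sigma)\,V^T$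 with $U_d^TU_d=V^TV=I$ and all $\sigma_j>0$. **Proposition.** Let $D\ge1$, $R\ge1$, all $l_d^r\ge1$, and assume that $D\ge3$ or $R=1$. Suppose that $\mathcal{A}_1+\dots+\mathcal{A}_R$ is an SBTD associated with the Tucker core structures $\mathcal{M}_1,\dots,\mathcal{M}_R$, with $\mathcal{A}_r=(U_1^r,\dots,U_D^r)\cdot\mathcal{C}_r$ in HOSVD form for $r=1,\dots,R$. Assume that $(U_d^{r_1})^TU_d^{r_2}=0$ for each $d$ and all $r_1\ne r_2$. Then $\kappa^{\mathrm{SBTD}}(\mathcal{A}_1,\dots,\mathcal{A}_R)=1$, whatever the cores $\mathcal{C}_r$ are. -/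

import Mathlib

open scoped ContDiff ENNReal Topology

noncomputable section

/-- Real tensors of order `D` and size `n 0 × ⋯ × n (D - 1)`, with the Frobenius norm. -/
abbrev Tensor {D : ℕ} (n : Fin D → ℕ) : Type :=
  EuclideanSpace ℝ ((d : Fin D) → Fin (n d))

/-- Multilinear multiplication `(U_1, …, U_D) · C`. -/
def multilinMul {D : ℕ} {n l : Fin D → ℕ} (U : (d : Fin D) → Matrix (Fin (n d)) (Fin (l d)) ℝ)
    (C : Tensor l) : Tensor n :=
  WithLp.toLp 2 fun i => ∑ j : (d : Fin D) → Fin (l d), (∏ d, U d (i d) (j d)) * C j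

/-- The `d`-th unfolding of a tensor: rows are indexed by the `d`-th index, columns by the tuple
of all the other indices. -/
def unfolding {D : ℕ} {n : Fin D → ℕ} (X : Tensor n) (d : Fin D) :
    Matrix (Fin (n d)) ((e : {e : Fin D // e ≠ d}) → Fin (n e)) ℝ :=
  Matrix.of fun i j => X ((Equiv.piSplitAt d fun e => Fin (n e)).symm (i, j))

/-- `S` is a smooth embedded submanifold of `E` (without boundary, of some fixed dimension `k`):
around each of its points there is a smooth chart of `E` that flattens `S` to a `k`-dimensional
linear subspace. -/
def IsSmoothSubmanifold {E : Type*} [NormedAddCommGroup E] [NormedSpace ℝ E] (S : Set E) : Prop :=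
  ∃ k : ℕ, ∀ x ∈ S, ∃ (φ : OpenPartialHomeomorph E E) (L : Submodule ℝ E),
    Module.finrank ℝ L = k ∧ x ∈ φ.source ∧
    ContDiffOn ℝ ∞ φ φ.source ∧ ContDiffOn ℝ ∞ φ.symm φ.target ∧
    ∀ y ∈ φ.source, y ∈ S ↔ φ y ∈ L

/-- Tucker core structure: a smooth submanifold of `ℝ^{l_1 × ⋯ × l_D}` that consists of tensors of
multilinear rank `(l_1, …, l_D)` and is invariant under `GL(l_1) × ⋯ × GL(l_D)`. -/
structure IsTuckerCoreStructure {D : ℕ} {l : Fin D → ℕ} (M : Set (Tensor l)) : Prop where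
  smooth : IsSmoothSubmanifold M
  multilinearRank : ∀ C ∈ M, ∀ d, (unfolding C d).rank = l d
  invariant : ∀ C ∈ M, ∀ G : (d : Fin D) → GL (Fin (l d)) ℝ,
    multilinMul (fun d => (G d : Matrix (Fin (l d)) (Fin (l d)) ℝ)) C ∈ M

/-- The `M`-structured Tucker manifold in `ℝ^{n_1 × ⋯ × n_D}`: all `(U_1, …, U_D) · C` with `C ∈ M`
and each `U_d` of full column rank. -/
def structuredTuckerManifold {D : ℕ} {l : Fin D → ℕ} (M : Set (Tensor l)) (n : Fin D → ℕ) :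
    Set (Tensor n) :=
  {X | ∃ C ∈ M, ∃ U : (d : Fin D) → Matrix (Fin (n d)) (Fin (l d)) ℝ,
    (∀ d, (U d).rank = l d) ∧ X = multilinMul U C}

/-- `T = A_1 + ⋯ + A_R` is a structured block term decomposition associated with the core
structures `M_1, …, M_R`. -/
def IsSBTD {D R : ℕ} {n : Fin D → ℕ} {l : Fin R → Fin D → ℕ} (M : (r : Fin R) → Set (Tensor (l r)))
    (T : Tensor n) (A : Fin R → Tensor n) : Prop :=
  (∀ r, A r ∈ structuredTuckerManifold (M r) n) ∧ T = ∑ r, A r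

/-- `X = (U_1, …, U_D) · C` is a compact HOSVD: the columns of each `U_d` are an orthonormal
system of left singular vectors of the `d`-th unfolding of `X` for all its nonzero singular values
(listed with multiplicity), that is, `U_d` is the left factor of a compact singular value
decomposition of that unfolding. -/
def IsHOSVD {D : ℕ} {n l : Fin D → ℕ} (X : Tensor n)
    (U : (d : Fin D) → Matrix (Fin (n d)) (Fin (l d)) ℝ) (C : Tensor l) : Prop :=
  X = multilinMul U C ∧
  ∀ d, (U d).transpose * U d = 1 ∧
    ∃ (σ : Fin (l d) → ℝ) (V : Matrix ((e : {e : Fin D // e ≠ d}) → Fin (n e)) (Fin (l d)) ℝ),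
      (∀ j, 0 < σ j) ∧ V.transpose * V = 1 ∧
      unfolding X d = U d * Matrix.diagonal σ * V.transpose

section Condition

variable {X Y : Type*} [NormedAddCommGroup X] [NormedAddCommGroup Y]

/-- `g` is a local inverse at `a` of the restriction of `f` to the set `P`: for a neighbourhood `N`
of `a` in `P`, the map `f : N → f(N)` has the continuous inverse `g : f(N) → N`. -/
structure IsLocalInverse (f : X → Y) (P : Set X) (a : X) (N : Set X) (g : Y → X) : Prop where
  mem : a ∈ N
  subset : N ⊆ P
  nhds : N ∈ 𝓝[P] a
  leftInv : Set.LeftInvOn g f N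
  continuousOn : ContinuousOn g (f '' N)

/-- The limit, as `δ` decreases to `0` (an infimum, since the supremum is monotone in `δ`), of
`sup ‖g (f a) - g y‖ / ‖f a - y‖` over all `y ∈ f(N)`, `y ≠ f a`, with `‖f a - y‖ ≤ δ`. -/
def localCondition (f : X → Y) (a : X) (N : Set X) (g : Y → X) : ℝ≥0∞ :=
  ⨅ (δ : ℝ) (_ : 0 < δ), ⨆ (y : Y) (_ : y ∈ f '' N) (_ : y ≠ f a) (_ : ‖f a - y‖ ≤ δ),
    ENNReal.ofReal (‖g (f a) - g y‖ / ‖f a - y‖)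

/-- The condition number at `a` of recovering `p ∈ P` from `f p`: the value of `localCondition` for
a local inverse, and `∞` if there is no local inverse. The value does not depend on the local
inverse (see `conditionNumber_eq`), and the infimum over the empty set is `∞`. -/
def conditionNumber (f : X → Y) (P : Set X) (a : X) : ℝ≥0∞ :=
  ⨅ (N : Set X) (g : Y → X) (_ : IsLocalInverse f P a N g), localCondition f a N g

theorem localCondition_le {f : X → Y} {P : Set X} {a : X} {N₁ N₂ : Set X} {g₁ g₂ : Y → X}
    (h₁ : IsLocalInverse f P a N₁ g₁) (h₂ : IsLocalInverse f P a N₂ g₂) :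
    localCondition f a N₁ g₁ ≤ localCondition f a N₂ g₂ := by
  obtain ⟨V, hV, haV, hVP⟩ := mem_nhdsWithin.1 h₂.nhds
  have hga : g₁ (f a) = a := h₁.leftInv h₁.mem
  have hc := h₁.continuousOn (f a) ⟨a, h₁.mem, rfl⟩
  have hev : g₁ ⁻¹' V ∈ 𝓝[f '' N₁] (f a) := hc (by rw [hga]; exact hV.mem_nhds haV)
  obtain ⟨ε, hε, hb⟩ := Metric.mem_nhdsWithin_iff.1 hev
  refine le_iInf₂ fun δ hδ => ?_
  refine (iInf₂_le (min δ (ε / 2)) (lt_min hδ (half_pos hε))).trans ?_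
  refine iSup_le fun y => iSup_le fun hy => iSup_le fun hne => iSup_le fun hd => ?_
  obtain ⟨p, hp, rfl⟩ := hy
  have hpV : g₁ (f p) ∈ V := by
    refine hb ⟨?_, ⟨p, hp, rfl⟩⟩
    rw [Metric.mem_ball, dist_comm, dist_eq_norm]
    have := hd.trans (min_le_right _ _)
    linarith
  rw [h₁.leftInv hp] at hpV
  have hp2 : p ∈ N₂ := hVP ⟨hpV, h₁.subset hp⟩
  have e : ENNReal.ofReal (‖g₁ (f a) - g₁ (f p)‖ / ‖f a - f p‖)
      = ENNReal.ofReal (‖g₂ (f a) - g₂ (f p)‖ / ‖f a - f p‖) := by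
    rw [h₁.leftInv hp, h₂.leftInv hp2, hga, h₂.leftInv h₂.mem]
  rw [e]
  exact le_iSup_of_le (f p) <| le_iSup_of_le ⟨p, hp2, rfl⟩ <| le_iSup_of_le hne <|
    le_iSup_of_le (hd.trans (min_le_left _ _)) le_rfl

theorem conditionNumber_eq {f : X → Y} {P : Set X} {a : X} {N : Set X} {g : Y → X}
    (h : IsLocalInverse f P a N g) : conditionNumber f P a = localCondition f a N g :=
  le_antisymm (iInf_le_of_le N <| iInf_le_of_le g <| iInf_le _ h)
    (le_iInf fun _ => le_iInf fun _ => le_iInf fun h' => localCondition_le h h')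

end Condition

/-- The condition number of the summands `(A_1, …, A_R)` of an SBTD: the condition number of
inverting the addition map on the product of the structured Tucker manifolds, where `R`-tuples of
tensors carry the product Euclidean norm. -/
def kappaSBTD {D R : ℕ} {n : Fin D → ℕ} {l : Fin R → Fin D → ℕ}
    (M : (r : Fin R) → Set (Tensor (l r))) (A : Fin R → Tensor n) : ℝ≥0∞ :=
  conditionNumber (fun B : PiLp 2 (fun _ : Fin R => Tensor n) => ∑ r, B r)
    {B | ∀ r, B r ∈ structuredTuckerManifold (M r) n} (WithLp.toLp 2 A)

end

/-! Upper bound: for tuples `B`, `B'` in the product of the Tucker manifolds and close to `A`, put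
`x r = B r - B' r`. It suffices that the `x r` are almost orthogonal pairwise: then `‖∑ r, x r‖ ≥ η
‖x‖` for any `η < 1`, which yields both a local inverse and the bound `η⁻¹` on the condition number,
and `η → 1`.

Almost orthogonality replaces tangent spaces by a rank argument. Near `A r`, the component of a
tensor normal to the column space of `U r d` is `K B B` with `K` smooth and `K (A r) = 0`
(`exists_modeMul_complement`). A component normal in two different modes thus contains two vanishing
factors, its derivative is zero at `A r`, and it is `ε`-Lipschitz nearby
(`eventually_norm_complement_le`). For `r ≠ s` the column spaces are orthogonal in every mode, so
each mode forces one of `x r`, `x s` into its normal part. With three modes and two tensors, one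
tensor is normal twice, hence small (`abs_inner_le_of_projections`).

Lower bound: rescaling a single nonzero summand stays in its manifold, and addition is isometric
along this curve. -/

/-- The unfolding of tensors along mode `d` as a linear equivalence. -/
noncomputable def unfoldingEquiv {D : ℕ} (n : Fin D → ℕ) (d : Fin D) :
    Tensor n ≃ₗ[ℝ] Matrix (Fin (n d)) ((e : {e : Fin D // e ≠ d}) → Fin (n e)) ℝ where
  toFun X := unfolding X d
  map_add' _ _ := rfl
  map_smul' _ _ := rfl
  invFun Y := WithLp.toLp 2 fun i => Y (i d) fun e => i e
  left_inv X := by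
    ext i
    exact congrArg X ((Equiv.piSplitAt d fun e => Fin (n e)).symm_apply_apply i)
  right_inv Y := by
    ext i j
    have h := (Equiv.piSplitAt d fun e => Fin (n e)).apply_symm_apply (i, j)
    exact congrArg₂ Y (congrArg Prod.fst h) (congrArg Prod.snd h)

/-- Multiplication of a tensor by a square matrix in mode `d`. -/
noncomputable def modeMul {D : ℕ} {n : Fin D → ℕ} (d : Fin D) :
    Matrix (Fin (n d)) (Fin (n d)) ℝ →ₗ[ℝ] (Tensor n →L[ℝ] Tensor n) where
  toFun M := LinearMap.toContinuousLinearMap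
    { toFun := fun X => (unfoldingEquiv n d).symm (M * unfolding X d)
      map_add' := fun X Y => by
        rw [← map_add, ← Matrix.mul_add]; rfl
      map_smul' := fun c X => by
        rw [RingHom.id_apply, ← map_smul, ← Matrix.mul_smul]; rfl }
  map_add' M N := by
    ext1 X
    change (unfoldingEquiv n d).symm _ = (unfoldingEquiv n d).symm _ + (unfoldingEquiv n d).symm _
    rw [← map_add, ← Matrix.add_mul]
  map_smul' c M := by
    ext1 X
    change (unfoldingEquiv n d).symm _ = c • (unfoldingEquiv n d).symm _
    rw [← map_smul, ← Matrix.smul_mul]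

/-- The `d`-th unfolding of `X` factors through `ℝ ^ m`, i.e. it has rank at most `m`. -/
def UnfoldingFactors {D : ℕ} {n : Fin D → ℕ} (X : Tensor n) (d : Fin D) (m : ℕ) : Prop :=
  ∃ (V : Matrix (Fin (n d)) (Fin m) ℝ)
    (Y : Matrix (Fin m) ((e : {e : Fin D // e ≠ d}) → Fin (n e)) ℝ), unfolding X d = V * Y

/-! ### Mode products and components normal to the factor matrices -/

section ModeMul

variable {D : ℕ} {n : Fin D → ℕ}

theorem unfolding_modeMul (d : Fin D) (M : Matrix (Fin (n d)) (Fin (n d)) ℝ) (X : Tensor n) :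
    unfolding (modeMul d M X) d = M * unfolding X d :=
  (unfoldingEquiv n d).apply_symm_apply (M * unfolding X d)

theorem unfolding_injective (d : Fin D) :
    Function.Injective fun X : Tensor n => unfolding X d :=
  (unfoldingEquiv n d).injective

theorem modeMul_one (d : Fin D) : modeMul (n := n) d 1 = 1 := by
  ext1 X
  exact unfolding_injective d (by simp [unfolding_modeMul])

theorem modeMul_mul (d : Fin D) (M N : Matrix (Fin (n d)) (Fin (n d)) ℝ) :
    modeMul d (M * N) = modeMul d M * modeMul d N := by
  ext1 X
  exact unfolding_injective d (by simp [unfolding_modeMul, Matrix.mul_assoc])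

theorem modeMul_apply (d : Fin D) (M : Matrix (Fin (n d)) (Fin (n d)) ℝ) (X : Tensor n)
    (i : (e : Fin D) → Fin (n e)) :
    modeMul d M X i = ∑ k, M (i d) k * X (Function.update i d k) := by
  change ∑ k, M (i d) k * X _ = _
  refine Finset.sum_congr rfl fun k _ => congrArg (fun j => M (i d) k * X j) ?_
  funext e
  by_cases h : e = d
  · subst h; simp [Equiv.piSplitAt]
  · simp [Equiv.piSplitAt, h]

theorem modeMul_comm {d e : Fin D} (hde : d ≠ e) (M : Matrix (Fin (n d)) (Fin (n d)) ℝ)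
    (N : Matrix (Fin (n e)) (Fin (n e)) ℝ) (X : Tensor n) :
    modeMul d M (modeMul e N X) = modeMul e N (modeMul d M X) := by
  ext i
  simp only [modeMul_apply, Finset.mul_sum, Function.update_of_ne hde,
    Function.update_of_ne hde.symm]
  rw [Finset.sum_comm]
  refine Finset.sum_congr rfl fun k _ => Finset.sum_congr rfl fun k' _ => ?_
  rw [Function.update_comm hde]
  ring

theorem inner_eq_trace (d : Fin D) (X Y : Tensor n) :
    inner ℝ X Y = ((unfolding X d).transpose * unfolding Y d).trace := by
  simp only [PiLp.inner_apply, Matrix.trace, Matrix.diag, Matrix.mul_apply, Matrix.transpose_apply]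
  rw [Finset.sum_comm, ← Fintype.sum_prod_type',
    ← (Equiv.piSplitAt d fun e => Fin (n e)).symm.sum_comp]
  refine Finset.sum_congr rfl fun p _ => ?_
  simp [unfolding, mul_comm]

theorem inner_modeMul_left (d : Fin D) (M : Matrix (Fin (n d)) (Fin (n d)) ℝ) (X Y : Tensor n) :
    inner ℝ (modeMul d M X) Y = inner ℝ X (modeMul d M.transpose Y) := by
  simp [inner_eq_trace d, unfolding_modeMul, Matrix.mul_assoc]

theorem norm_modeMul_le {d : Fin D} {M : Matrix (Fin (n d)) (Fin (n d)) ℝ}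
    (hM : M.transpose = M) (hM' : M * M = M) (X : Tensor n) : ‖modeMul d M X‖ ≤ ‖X‖ := by
  have h : ‖modeMul d M X‖ * ‖modeMul d M X‖ ≤ ‖X‖ * ‖modeMul d M X‖ := by
    rw [← real_inner_self_eq_norm_mul_norm, inner_modeMul_left, hM,
      ← mul_apply_eq_comp, ← modeMul_mul, hM']
    exact real_inner_le_norm _ _
  rcases (norm_nonneg (modeMul d M X)).eq_or_lt with h0 | h0
  · rw [← h0]; exact norm_nonneg _
  · exact le_of_mul_le_mul_right h h0

/-- The left factor is `V d`; the right one is the unfolding of `C` multiplied in all the other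
modes. -/
theorem unfoldingFactors_multilinMul {l : Fin D → ℕ} (V : (d : Fin D) → Matrix (Fin (n d)) (Fin (l d)) ℝ)
    (C : Tensor l) (d : Fin D) :
    UnfoldingFactors (multilinMul V C) d (l d) := by
  refine ⟨V d, Matrix.of fun k i' => ∑ j : (e : Fin D) → Fin (l e), if j d = k then
    (∏ e : {e : Fin D // e ≠ d}, V e (i' e) (j e)) * C j else 0, ?_⟩
  ext k i'
  simp only [unfolding, multilinMul, Matrix.of_apply, Matrix.mul_apply, Finset.mul_sum]
  rw [Finset.sum_comm]
  refine Finset.sum_congr rfl fun j _ => ?_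
  simp only [mul_ite, mul_zero, Finset.sum_ite_eq, Finset.mem_univ, if_true]
  rw [← mul_assoc, ← Fintype.prod_subtype_mul_prod_subtype (fun e => e = d)]
  congr 2
  · trans V d ((Equiv.piSplitAt d fun e => Fin (n e)).symm (k, i') d) (j d)
    · convert Fintype.prod_subsingleton (fun e : {e : Fin D // e = d} =>
        V e ((Equiv.piSplitAt d fun e => Fin (n e)).symm (k, i') e) (j e)) ⟨d, rfl⟩
    · simp [Equiv.piSplitAt]
  · refine Finset.prod_congr rfl fun e _ => ?_
    simp [Equiv.piSplitAt, e.2]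

/-- Near a tensor `A` whose `d`-th unfolding has column space spanned by the orthonormal columns of
`U`, the component orthogonal to `U` of a tensor of the same rank in mode `d` is a smooth function,
vanishing at `A`, applied to the tensor. -/
theorem exists_modeMul_complement {m : ℕ} (d : Fin D) (A : Tensor n)
    (U : Matrix (Fin (n d)) (Fin m) ℝ)
    (W : Matrix ((e : {e : Fin D // e ≠ d}) → Fin (n e)) (Fin m) ℝ)
    (hU : U.transpose * U = 1) (hW : unfolding A d * W = U) :
    ∃ K : Tensor n → Tensor n →L[ℝ] Tensor n, ContDiffAt ℝ 1 K A ∧ K A = 0 ∧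
      ∀ᶠ B in 𝓝 A, (∃ κ, K B = modeMul d κ) ∧
        (UnfoldingFactors B d m →
          modeMul d (1 - U * U.transpose) B = K B B) := by
  set P := U * U.transpose with hP
  have hPP : P * P = P := by
    rw [hP, Matrix.mul_assoc, ← Matrix.mul_assoc U.transpose, hU, Matrix.one_mul]
  have hPU : U.transpose * P = U.transpose := by rw [hP, ← Matrix.mul_assoc, hU, Matrix.one_mul]
  have hUP : P * U = U := by rw [hP, Matrix.mul_assoc, hU, Matrix.mul_one]
  let T : Tensor n →ₗ[ℝ] (Tensor n →L[ℝ] Tensor n) :=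
    modeMul d ∘ₗ
      { toFun := fun B => unfolding B d * W * U.transpose
        map_add' := fun X Y => by rw [← Matrix.add_mul, ← Matrix.add_mul]; rfl
        map_smul' := fun c X => by
          rw [RingHom.id_apply, ← Matrix.smul_mul, ← Matrix.smul_mul]; rfl }
  have hT : ∀ B, T B = modeMul d (unfolding B d * W * U.transpose) := fun _ => rfl
  have hTc : ContDiff ℝ 1 T := (LinearMap.toContinuousLinearMap T).contDiff
  have hTA : T A = modeMul d P := by rw [hT, hW]
  -- Writing `X` for the unfolding of `B` and `G = Uᵀ X W`, `S B` acts as `G` on the range of `U`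
  -- and as the identity on its complement. Inverting it therefore inverts `G` smoothly, and `K B`
  -- becomes the mode product with `(1 - P) X W G⁻¹ Uᵀ`.
  let S : Tensor n → Tensor n →L[ℝ] Tensor n := fun B => modeMul d (1 - P) + modeMul d P * T B
  have hS : ContDiff ℝ 1 S := (contDiff_const (𝕜 := ℝ)).add ((contDiff_const (𝕜 := ℝ)).mul hTc)
  have hSA : S A = 1 := by
    simp only [S]
    rw [hTA, ← modeMul_mul, hPP, ← map_add, sub_add_cancel, modeMul_one]
  refine ⟨fun B => modeMul d (1 - P) * T B * Ring.inverse (S B), ?_, ?_, ?_⟩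
  · refine ((contDiffAt_const (𝕜 := ℝ)).mul hTc.contDiffAt).mul ?_
    have hi : ContDiffAt ℝ 1 Ring.inverse (S A) := by
      rw [hSA]
      exact contDiffAt_ringInverse ℝ (1 : (Tensor n →L[ℝ] Tensor n)ˣ)
    exact ContDiffAt.comp A hi hS.contDiffAt
  · simp only
    rw [hTA, ← modeMul_mul, Matrix.sub_mul, Matrix.one_mul, hPP, sub_self, map_zero, zero_mul]
  · have hG : ∀ᶠ B in 𝓝 A, (U.transpose * unfolding B d * W).det ≠ 0 := by
      have hc : Continuous fun B : Tensor n => unfolding B d :=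
        (LinearMap.toContinuousLinearMap (unfoldingEquiv n d).toLinearMap).continuous
      refine (Continuous.matrix_det ((continuous_const.matrix_mul hc).matrix_mul
        continuous_const)).continuousAt.eventually_ne ?_
      rw [Matrix.mul_assoc, hW, hU, Matrix.det_one]
      exact one_ne_zero
    filter_upwards [hG] with B hB
    set G := U.transpose * unfolding B d * W with hGdef
    have hGu : IsUnit G.det := hB.isUnit
    have hinv : Ring.inverse (S B) = modeMul d (1 - P + U * G⁻¹ * U.transpose) := by
      have hSB : S B = modeMul d (1 - P + U * G * U.transpose) := by
        simp only [S]
        rw [hT, ← modeMul_mul, ← map_add]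
        simp only [hP, hGdef, Matrix.mul_assoc]
      have key : ∀ G H : Matrix (Fin m) (Fin m) ℝ, G * H = 1 →
          (1 - P + U * G * U.transpose) * (1 - P + U * H * U.transpose) = 1 := by
        intro G H h
        have e1 : (1 - P) * U = 0 := by rw [Matrix.sub_mul, hUP, Matrix.one_mul, sub_self]
        have e2 : U.transpose * (1 - P) = 0 := by
          rw [Matrix.mul_sub, hPU, Matrix.mul_one, sub_self]
        have e3 : (1 - P) * (1 - P) = 1 - P := by
          rw [Matrix.mul_sub, Matrix.mul_one, Matrix.sub_mul, Matrix.one_mul, hPP, sub_self,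
            sub_zero]
        have e4 : U * G * U.transpose * (U * H * U.transpose) = P := by
          calc _ = U * (G * (U.transpose * U) * H) * U.transpose := by
                simp only [Matrix.mul_assoc]
            _ = P := by rw [hU, Matrix.mul_one, h, Matrix.mul_one]
        rw [Matrix.add_mul, Matrix.mul_add, Matrix.mul_add, e3, e4, Matrix.mul_assoc _ _ (1 - P),
          e2, ← Matrix.mul_assoc (1 - P), ← Matrix.mul_assoc (1 - P), e1]
        simp
      rw [hSB]
      refine Ring.inverse_unit (⟨_, modeMul d (1 - P + U * G⁻¹ * U.transpose), ?_, ?_⟩ :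
        (Tensor n →L[ℝ] Tensor n)ˣ)
      · rw [← modeMul_mul, key _ _ (Matrix.mul_nonsing_inv G hGu), modeMul_one]
      · rw [← modeMul_mul, key _ _ (Matrix.nonsing_inv_mul G hGu), modeMul_one]
    have hU' : U.transpose * (1 - P + U * G⁻¹ * U.transpose) = G⁻¹ * U.transpose := by
      rw [Matrix.mul_add, Matrix.mul_sub, hPU, Matrix.mul_one, sub_self, zero_add,
        ← Matrix.mul_assoc, ← Matrix.mul_assoc, hU, Matrix.one_mul]
    have hK : modeMul d (1 - P) * T B * Ring.inverse (S B) =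
        modeMul d ((1 - P) * (unfolding B d * W * (G⁻¹ * U.transpose))) := by
      rw [hinv, hT, ← modeMul_mul, ← modeMul_mul, Matrix.mul_assoc, Matrix.mul_assoc, hU',
        Matrix.mul_assoc]
    refine ⟨⟨_, hK⟩, ?_⟩
    rintro ⟨V, Y, hVY⟩
    rw [hK, modeMul_mul, mul_apply_eq_comp]
    congr 1
    refine unfolding_injective d ?_
    simp only [unfolding_modeMul]
    have hGV : G = U.transpose * V * (Y * W) := by
      rw [hGdef, hVY]; simp only [Matrix.mul_assoc]
    -- `V` has exactly `m` columns, so `G` is a product of two square matrices and the one-sided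
    -- inverse is two-sided. This gives `X = X W G⁻¹ Uᵀ X`.
    have hmid : Y * W * (G⁻¹ * (U.transpose * V)) = 1 := by
      refine mul_eq_one_comm.1 ?_
      rw [Matrix.mul_assoc, ← hGV, Matrix.nonsing_inv_mul G hGu]
    calc unfolding B d = V * (Y * W * (G⁻¹ * (U.transpose * V))) * Y := by
          rw [hmid, Matrix.mul_one, hVY]
      _ = _ := by rw [hVY]; simp only [Matrix.mul_assoc]

/-- Second-order smallness: on tensors of bounded rank in the modes `d` and `e`, the component
normal in both modes has arbitrarily small Lipschitz constant near `A`. -/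
theorem eventually_norm_complement_le {d e : Fin D} (hde : d ≠ e) (A : Tensor n) {m m' : ℕ}
    {U : Matrix (Fin (n d)) (Fin m) ℝ} {U' : Matrix (Fin (n e)) (Fin m') ℝ}
    {W : Matrix ((f : {f : Fin D // f ≠ d}) → Fin (n f)) (Fin m) ℝ}
    {W' : Matrix ((f : {f : Fin D // f ≠ e}) → Fin (n f)) (Fin m') ℝ}
    (hU : U.transpose * U = 1) (hW : unfolding A d * W = U)
    (hU' : U'.transpose * U' = 1) (hW' : unfolding A e * W' = U')
    (S : Set (Tensor n))
    (hS : ∀ B ∈ S, UnfoldingFactors B d m)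
    (hS' : ∀ B ∈ S, UnfoldingFactors B e m')
    {ε : ℝ} (hε : 0 < ε) :
    ∀ᶠ p in 𝓝 (A, A), p.1 ∈ S → p.2 ∈ S →
      ‖modeMul d (1 - U * U.transpose) (modeMul e (1 - U' * U'.transpose) (p.1 - p.2))‖
        ≤ ε * ‖p.1 - p.2‖ := by
  obtain ⟨K, hK, hKA, hKB⟩ := exists_modeMul_complement d A U W hU hW
  obtain ⟨K', hK', hKA', hKB'⟩ := exists_modeMul_complement e A U' W' hU' hW'
  -- By the product rule, every term in the derivative of `B ↦ K' B (K B B)` at `A` contains `K A`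
  -- or `K' A`, so it vanishes; strictness controls differences of two nearby points.
  have hF := (hK'.hasStrictFDerivAt one_ne_zero).clm_apply
    ((hK.hasStrictFDerivAt one_ne_zero).clm_apply (hasStrictFDerivAt_id A))
  have hlo := hF.isLittleO.def hε
  have hev := hKB.and hKB'
  rw [nhds_prod_eq] at hlo ⊢
  filter_upwards [hlo, hev.prod_mk hev] with p hp hq h1 h2
  have key : ∀ B ∈ S, ((∃ κ, K B = modeMul d κ) ∧
        (UnfoldingFactors B d m →
          modeMul d (1 - U * U.transpose) B = K B B)) ∧ ((∃ κ, K' B = modeMul e κ) ∧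
        (UnfoldingFactors B e m' →
          modeMul e (1 - U' * U'.transpose) B = K' B B)) →
      modeMul d (1 - U * U.transpose) (modeMul e (1 - U' * U'.transpose) B) = K' B (K B B) := by
    rintro B hB ⟨⟨-, h⟩, ⟨κ, hκ⟩, h'⟩
    -- Being a mode-`e` product, `K' B` commutes with the mode-`d` projection.
    rw [h' (hS' B hB), hκ, modeMul_comm hde, h (hS B hB)]
  rw [map_sub (modeMul e (1 - U' * U'.transpose)), map_sub (modeMul d (1 - U * U.transpose)), key _ h1 hq.1, key _ h2 hq.2]
  simpa [hKA, hKA'] using hp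

end ModeMul

/-! ### Almost orthogonality in inner product spaces -/

/-- Two vectors whose doubly normal components in three modes are small are almost orthogonal, if
the tangential projections of the two are mutually orthogonal in each of the modes. -/
theorem abs_inner_le_of_projections {H : Type*} [NormedAddCommGroup H] [InnerProductSpace ℝ H]
    (P Q Q' : Fin 3 → H →L[ℝ] H) {x y : H} {ε : ℝ}
    (hsplit : ∀ i u v, inner ℝ u v = inner ℝ (Q i u) v + inner ℝ (P i u) (Q' i v))
    (hPn : ∀ i u, ‖P i u‖ ≤ ‖u‖) (hQn : ∀ i u, ‖Q i u‖ ≤ ‖u‖) (hQn' : ∀ i u, ‖Q' i u‖ ≤ ‖u‖)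
    (hcomm : ∀ i j, i ≠ j → ∀ u, Q i (P j u) = P j (Q i u))
    (hx : ∀ i j, i ≠ j → ‖Q i (Q j x)‖ ≤ ε * ‖x‖)
    (hy : ∀ i j, i ≠ j → ‖Q' i (Q' j y)‖ ≤ ε * ‖y‖) :
    |inner ℝ x y| ≤ 6 * ε * (‖x‖ * ‖y‖) := by
  have key : ∀ u v : H, ∀ a b, ‖u‖ ≤ a → ‖v‖ ≤ b → |inner ℝ u v| ≤ a * b := fun u v a b hu hv =>
    (abs_real_inner_le_norm u v).trans
      (mul_le_mul hu hv (norm_nonneg _) ((norm_nonneg _).trans hu))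
  have h01 : (0 : Fin 3) ≠ 1 := by decide
  have h02 : (0 : Fin 3) ≠ 2 := by decide
  have h12 : (1 : Fin 3) ≠ 2 := by decide
  -- Split mode by mode, stopping once `x` or `y` carries two normal projections. The tree has six
  -- leaves, whence the constant `6`.
  have e : inner ℝ x y =
      inner ℝ (Q 1 (Q 0 x)) y + inner ℝ (P 1 (Q 2 (Q 0 x))) (Q' 1 y)
        + inner ℝ (P 2 (P 1 (Q 0 x))) (Q' 2 (Q' 1 y))
        + (inner ℝ (P 0 (Q 2 (Q 1 x))) (Q' 0 y)
        + inner ℝ (P 2 (Q 1 (P 0 x))) (Q' 2 (Q' 0 y)) + inner ℝ (P 1 (P 0 x)) (Q' 1 (Q' 0 y))) := by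
    rw [hsplit 0 x y, hsplit 1 (Q 0 x) y, hsplit 1 (P 0 x) (Q' 0 y),
      hsplit 2 (P 1 (Q 0 x)) (Q' 1 y), hsplit 2 (Q 1 (P 0 x)) (Q' 0 y),
      hcomm 2 1 h12.symm, hcomm 1 0 h01.symm, hcomm 2 0 h02.symm]
    ring
  have b1 := key (Q 1 (Q 0 x)) y _ _ (hx 1 0 h01.symm) le_rfl
  have b2 := key (P 1 (Q 2 (Q 0 x))) (Q' 1 y) _ _ ((hPn _ _).trans (hx 2 0 h02.symm)) (hQn' _ _)
  have b3 := key (P 2 (P 1 (Q 0 x))) (Q' 2 (Q' 1 y)) _ _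
    (((hPn _ _).trans (hPn _ _)).trans (hQn _ _)) (hy 2 1 h12.symm)
  have b4 := key (P 0 (Q 2 (Q 1 x))) (Q' 0 y) _ _ ((hPn _ _).trans (hx 2 1 h12.symm)) (hQn' _ _)
  have b5 := key (P 2 (Q 1 (P 0 x))) (Q' 2 (Q' 0 y)) _ _
    (((hPn _ _).trans (hQn _ _)).trans (hPn _ _)) (hy 2 0 h02.symm)
  have b6 := key (P 1 (P 0 x)) (Q' 1 (Q' 0 y)) _ _ ((hPn _ _).trans (hPn _ _)) (hy 1 0 h01.symm)
  rw [abs_le] at *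
  rw [e]
  constructor <;> linarith [b1.1, b1.2, b2.1, b2.2, b3.1, b3.2, b4.1, b4.2, b5.1, b5.2, b6.1, b6.2]

/-- Expand the square: each of the `R ^ 2` pairs, diagonal ones included, is charged an error `ε *
‖x‖ ^ 2`. -/
theorem norm_sq_sum_ge_of_abs_inner_le {H : Type*} [NormedAddCommGroup H] [InnerProductSpace ℝ H]
    {R : ℕ} (x : PiLp 2 (fun _ : Fin R => H)) {ε : ℝ} (hε : 0 ≤ ε)
    (h : ∀ r s, r ≠ s → |inner ℝ (x r) (x s)| ≤ ε * (‖x r‖ * ‖x s‖)) :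
    (1 - ε * R ^ 2) * ‖x‖ ^ 2 ≤ ‖∑ r, x r‖ ^ 2 := by
  have hle : ∀ r, ‖x r‖ ≤ ‖x‖ := fun r => PiLp.norm_apply_le x r
  have h1 : ∀ r s, (if r = s then ‖x r‖ ^ 2 else 0) - ε * ‖x‖ ^ 2 ≤ inner ℝ (x r) (x s) := by
    intro r s
    have h0 : 0 ≤ ε * ‖x‖ ^ 2 := by positivity
    split_ifs with hrs
    · subst hrs
      rw [real_inner_self_eq_norm_sq]; linarith
    · have h2 : ‖x r‖ * ‖x s‖ ≤ ‖x‖ ^ 2 := by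
        rw [sq]; exact mul_le_mul (hle r) (hle s) (norm_nonneg _) (norm_nonneg _)
      have := (abs_le.1 (h r s hrs)).1
      have := mul_le_mul_of_nonneg_left h2 hε
      linarith
  calc (1 - ε * R ^ 2) * ‖x‖ ^ 2
      = ∑ r, ∑ s, ((if r = s then ‖x r‖ ^ 2 else 0) - ε * ‖x‖ ^ 2) := by
        simp only [Finset.sum_sub_distrib, Finset.sum_ite_eq, Finset.mem_univ, if_true,
          Finset.sum_const, Finset.card_univ, Fintype.card_fin, nsmul_eq_mul]
        rw [← PiLp.norm_sq_eq_of_L2]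
        ring
    _ ≤ ∑ r, ∑ s, inner ℝ (x r) (x s) :=
        Finset.sum_le_sum fun r _ => Finset.sum_le_sum fun s _ => h1 r s
    _ = ‖∑ r, x r‖ ^ 2 := by
        rw [← real_inner_self_eq_norm_sq, sum_inner]
        simp only [inner_sum]

/-! ### Bounds for the condition number -/

section Condition

variable {X Y : Type*} [NormedAddCommGroup X] [NormedAddCommGroup Y]

/-- A lower Lipschitz bound near `a` on `P` provides a local inverse and an upper bound for the
condition number. -/
theorem conditionNumber_le_of_lowerBound {f : X → Y} {P : Set X} {a : X} (ha : a ∈ P) {η : ℝ}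
    (hη : 0 < η)
    (h : ∀ᶠ p in 𝓝 (a, a), p.1 ∈ P → p.2 ∈ P → η * ‖p.1 - p.2‖ ≤ ‖f p.1 - f p.2‖) :
    conditionNumber f P a ≤ ENNReal.ofReal η⁻¹ := by
  rw [nhds_prod_eq] at h
  obtain ⟨V, hV, hb⟩ := Filter.eventually_prod_self_iff'.1 h
  have haV : a ∈ V := mem_of_mem_nhds hV
  let N := V ∩ P
  have hbN : ∀ x ∈ N, ∀ y ∈ N, η * ‖x - y‖ ≤ ‖f x - f y‖ := fun x hx y hy =>
    hb x hx.1 y hy.1 hx.2 hy.2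
  have hinj : Set.InjOn f N := by
    intro x hx y hy hxy
    have := hbN x hx y hy
    rw [hxy, sub_self, norm_zero] at this
    have h0 : ‖x - y‖ ≤ 0 := nonpos_of_mul_nonpos_right this hη
    exact sub_eq_zero.1 (norm_le_zero_iff.1 h0)
  have : Nonempty X := ⟨a⟩
  have hL : Set.LeftInvOn (Function.invFunOn f N) f N := hinj.leftInvOn_invFunOn
  have hN : IsLocalInverse f P a N (Function.invFunOn f N) := by
    refine ⟨⟨haV, ha⟩, Set.inter_subset_right, Filter.inter_mem
      (mem_nhdsWithin_of_mem_nhds hV) self_mem_nhdsWithin, hL, ?_⟩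
    have : LipschitzOnWith (Real.toNNReal η⁻¹) (Function.invFunOn f N) (f '' N) := by
      refine LipschitzOnWith.of_dist_le_mul ?_
      rintro _ ⟨x, hx, rfl⟩ _ ⟨y, hy, rfl⟩
      rw [hL hx, hL hy, dist_eq_norm, dist_eq_norm, Real.coe_toNNReal _ (inv_nonneg.2 hη.le),
        inv_mul_eq_div, le_div_iff₀' hη]
      exact hbN x hx y hy
    exact this.continuousOn
  rw [conditionNumber_eq hN]
  -- Any `δ` would do, since the Lipschitz bound holds on all of `N`.
  refine iInf₂_le_of_le 1 one_pos ?_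
  refine iSup_le fun y => iSup_le fun hy => iSup_le fun hne => iSup_le fun _ => ?_
  obtain ⟨x, hx, rfl⟩ := hy
  refine ENNReal.ofReal_le_ofReal ?_
  rw [hL hx, hL hN.mem, div_le_iff₀ (norm_pos_iff.2 (sub_ne_zero.2 hne.symm)), inv_mul_eq_div,
    le_div_iff₀' hη]
  exact hbN _ hN.mem _ hx

/-- A curve in `P` through `a` along which `f` is isometric at `a` bounds the condition number from
below by `1`. -/
theorem one_le_conditionNumber {f : X → Y} {P : Set X} {a : X} (γ : ℕ → X)
    (hγ : Filter.Tendsto γ Filter.atTop (𝓝 a)) (hP : ∀ k, γ k ∈ P) (hne : ∀ k, γ k ≠ a)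
    (hiso : ∀ k, ‖f a - f (γ k)‖ = ‖a - γ k‖) : 1 ≤ conditionNumber f P a := by
  refine le_iInf fun N => le_iInf fun g => le_iInf fun h => le_iInf₂ fun δ hδ => ?_
  have h1 : ∀ᶠ k in Filter.atTop, γ k ∈ N :=
    (tendsto_nhdsWithin_iff.2 ⟨hγ, Filter.Eventually.of_forall hP⟩).eventually h.nhds
  have h2 : ∀ᶠ k in Filter.atTop, γ k ∈ Metric.ball a δ :=
    hγ.eventually (Metric.ball_mem_nhds a hδ)
  obtain ⟨k, hk, hkδ⟩ := (h1.and h2).exists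
  have hpos : 0 < ‖a - γ k‖ := norm_pos_iff.2 (sub_ne_zero.2 (hne k).symm)
  rw [Metric.mem_ball, dist_comm, dist_eq_norm] at hkδ
  refine le_iSup_of_le (f (γ k)) <| le_iSup_of_le ⟨_, hk, rfl⟩ <| le_iSup_of_le (fun h0 => ?_) <|
    le_iSup_of_le ((hiso k).trans_le hkδ.le) ?_
  · rw [← hiso k, h0, sub_self, norm_zero] at hpos
    exact lt_irrefl _ hpos
  · rw [h.leftInv h.mem, h.leftInv hk, hiso k, div_self hpos.ne', ENNReal.ofReal_one]

end Condition

/-! ### Structured Tucker manifolds and the addition map -/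

section SBTD

variable {D : ℕ} {n l : Fin D → ℕ}

theorem IsHOSVD.exists_unfolding_mul_eq {X : Tensor n}
    {U : (d : Fin D) → Matrix (Fin (n d)) (Fin (l d)) ℝ} {C : Tensor l} (h : IsHOSVD X U C)
    (d : Fin D) :
    ∃ W : Matrix ((e : {e : Fin D // e ≠ d}) → Fin (n e)) (Fin (l d)) ℝ,
      unfolding X d * W = U d := by
  obtain ⟨-, σ, V, hσ, hV, hX⟩ := h.2 d
  -- The SVD is solved for its left factor, which is possible as all `σ j` are positive.
  refine ⟨V * Matrix.diagonal fun j => (σ j)⁻¹, ?_⟩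
  calc unfolding X d * (V * Matrix.diagonal fun j => (σ j)⁻¹)
      = U d * Matrix.diagonal σ * (V.transpose * V) * Matrix.diagonal fun j => (σ j)⁻¹ := by
        rw [hX]; simp only [Matrix.mul_assoc]
    _ = U d := by
        rw [hV, Matrix.mul_one, Matrix.mul_assoc, Matrix.diagonal_mul_diagonal]
        simp [fun j => mul_inv_cancel₀ (hσ j).ne']

theorem IsHOSVD.ne_zero {X : Tensor n}
    {U : (d : Fin D) → Matrix (Fin (n d)) (Fin (l d)) ℝ} {C : Tensor l} (h : IsHOSVD X U C)
    (d : Fin D) (hl : 1 ≤ l d) : X ≠ 0 := by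
  rintro rfl
  obtain ⟨W, hW⟩ := h.exists_unfolding_mul_eq d
  have h0 : unfolding (0 : Tensor n) d = 0 := rfl
  have h1 := (h.2 d).1
  rw [← hW, h0, Matrix.zero_mul, Matrix.mul_zero] at h1
  have := congrFun (congrFun h1 ⟨0, hl⟩) ⟨0, hl⟩
  simp at this

theorem unfoldingFactors_of_mem_structuredTuckerManifold {M : Set (Tensor l)} {X : Tensor n}
    (h : X ∈ structuredTuckerManifold M n) (d : Fin D) : UnfoldingFactors X d (l d) := by
  obtain ⟨C, -, U, -, rfl⟩ := h
  exact unfoldingFactors_multilinMul U C d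

theorem smul_mem_structuredTuckerManifold {M : Set (Tensor l)} {X : Tensor n}
    (h : X ∈ structuredTuckerManifold M n) (d : Fin D) {t : ℝ} (ht : t ≠ 0) :
    t • X ∈ structuredTuckerManifold M n := by
  obtain ⟨C, hC, U, hU, rfl⟩ := h
  refine ⟨C, hC, fun e => (if e = d then t else 1) • U e, fun e => ?_, ?_⟩
  · rw [Matrix.rank_smul_of_mem_nonZeroDivisors _
      (mem_nonZeroDivisors_of_ne_zero (by split_ifs <;> simp [ht])), hU]
  · ext i
    simp only [multilinMul, PiLp.smul_apply, smul_eq_mul, Matrix.smul_apply, Finset.mul_sum,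
      Finset.prod_mul_distrib, Finset.prod_ite_eq', Finset.mem_univ, if_true, mul_assoc]

theorem isProjection_of_transpose_mul_self_eq_one {m k : ℕ} {U : Matrix (Fin m) (Fin k) ℝ}
    (hU : U.transpose * U = 1) :
    (U * U.transpose).transpose = U * U.transpose ∧
      U * U.transpose * (U * U.transpose) = U * U.transpose ∧
      (1 - U * U.transpose).transpose = 1 - U * U.transpose ∧
      (1 - U * U.transpose) * (1 - U * U.transpose) = 1 - U * U.transpose := by
  have h1 : (U * U.transpose).transpose = U * U.transpose := by simp
  have h2 : U * U.transpose * (U * U.transpose) = U * U.transpose := by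
    rw [Matrix.mul_assoc, ← Matrix.mul_assoc U.transpose, hU, Matrix.one_mul]
  refine ⟨h1, h2, by simp, ?_⟩
  rw [Matrix.mul_sub, Matrix.mul_one, Matrix.sub_mul, Matrix.one_mul, h2, sub_self, sub_zero]

/-- The projections onto the ranges of `U` and `U'` have product zero, so the tangential part of `x`
only meets the normal part of `y`. -/
theorem inner_eq_add_of_transpose_mul_eq_zero (d : Fin D) {k k' : ℕ}
    {U : Matrix (Fin (n d)) (Fin k) ℝ} {U' : Matrix (Fin (n d)) (Fin k') ℝ}
    (h : U.transpose * U' = 0) (x y : Tensor n) :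
    inner ℝ x y = inner ℝ (modeMul d (1 - U * U.transpose) x) y +
      inner ℝ (modeMul d (U * U.transpose) x) (modeMul d (1 - U' * U'.transpose) y) := by
  have h0 : U * U.transpose * (U' * U'.transpose) = 0 := by
    rw [Matrix.mul_assoc, ← Matrix.mul_assoc U.transpose, h, Matrix.zero_mul, Matrix.mul_zero]
  have h1 : inner ℝ (modeMul d (U * U.transpose) x) (modeMul d (U' * U'.transpose) y) = 0 := by
    rw [inner_modeMul_left, Matrix.transpose_mul, Matrix.transpose_transpose,
      ← mul_apply_eq_comp, ← modeMul_mul, h0, map_zero]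
    exact inner_zero_right x
  simp only [map_sub, modeMul_one, sub_apply, one_apply_eq_self,
    inner_sub_left, inner_sub_right, h1]
  ring

/-- The addition map on tensors of bounded multilinear rank is almost isometric near summands with
pairwise orthogonal factor matrices. -/
theorem eventually_le_norm_sum_sub {R : ℕ} {l : Fin R → Fin D → ℕ} (hDR : 2 ≤ R → 3 ≤ D)
    (A : PiLp 2 (fun _ : Fin R => Tensor n))
    (U : (r : Fin R) → (d : Fin D) → Matrix (Fin (n d)) (Fin (l r d)) ℝ)
    (hU : ∀ r d, (U r d).transpose * U r d = 1)
    (hW : ∀ r d, ∃ W : Matrix ((e : {e : Fin D // e ≠ d}) → Fin (n e)) (Fin (l r d)) ℝ,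
      unfolding (A r) d * W = U r d)
    (horth : ∀ d, ∀ r₁ r₂, r₁ ≠ r₂ → (U r₁ d).transpose * U r₂ d = 0)
    (S : Fin R → Set (Tensor n)) (hS : ∀ r d, ∀ B ∈ S r, UnfoldingFactors B d (l r d))
    {η : ℝ} (hη₀ : 0 ≤ η) (hη : η < 1) :
    ∀ᶠ p in 𝓝 (A, A), (∀ r, p.1 r ∈ S r) → (∀ r, p.2 r ∈ S r) →
      η * ‖p.1 - p.2‖ ≤ ‖∑ r, p.1 r - ∑ r, p.2 r‖ := by
  have h2 : 0 < 1 - η ^ 2 := by nlinarith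
  obtain ⟨ε, hε, hεη⟩ : ∃ ε : ℝ, 0 < ε ∧ η ^ 2 ≤ 1 - 6 * ε * R ^ 2 := by
    refine ⟨(1 - η ^ 2) / (6 * (R ^ 2 + 1)), by positivity, ?_⟩
    have h3 : 6 * ((1 - η ^ 2) / (6 * (R ^ 2 + 1))) * R ^ 2
        = (1 - η ^ 2) * (R ^ 2 / ((R : ℝ) ^ 2 + 1)) := by field_simp
    have h4 : (R : ℝ) ^ 2 / (R ^ 2 + 1) ≤ 1 := by
      rw [div_le_one (by positivity)]; linarith
    rw [h3]
    have := mul_le_mul_of_nonneg_left h4 h2.le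
    linarith
  have hsmall : ∀ᶠ p in 𝓝 (A, A), ∀ r d e, d ≠ e → p.1 r ∈ S r → p.2 r ∈ S r →
      ‖modeMul d (1 - U r d * (U r d).transpose) (modeMul e (1 - U r e * (U r e).transpose)
        (p.1 r - p.2 r))‖ ≤ ε * ‖p.1 r - p.2 r‖ := by
    refine Filter.eventually_all.2 fun r => Filter.eventually_all.2 fun d =>
      Filter.eventually_all.2 fun e => ?_
    by_cases hde : d = e
    · exact Filter.Eventually.of_forall fun p h => absurd hde h
    obtain ⟨W, hWd⟩ := hW r d
    obtain ⟨W', hWe⟩ := hW r e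
    have h := eventually_norm_complement_le hde (A r) (hU r d) hWd (hU r e) hWe (S r) (hS r d)
      (hS r e) hε
    have hc : Continuous fun p : PiLp 2 (fun _ : Fin R => Tensor n) ×
        PiLp 2 (fun _ : Fin R => Tensor n) => (p.1 r, p.2 r) := by fun_prop
    filter_upwards [hc.continuousAt.eventually h] with p hp _ using hp
  filter_upwards [hsmall] with p hp h1 h2
  rw [← Finset.sum_sub_distrib]
  have hge := norm_sq_sum_ge_of_abs_inner_le (p.1 - p.2) (ε := 6 * ε) (by positivity)
    fun r s hrs => by
      -- Two distinct summands force `2 ≤ R`; for `R = 1` there is no pair to treat.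
      have hD : 3 ≤ D := hDR (by
        have := r.2; have := s.2; have : (r : ℕ) ≠ s := fun h => hrs (Fin.ext h)
        omega)
      let c : Fin 3 → Fin D := Fin.castLE hD
      have hc : ∀ i j, i ≠ j → c i ≠ c j := fun i j hij h => hij (Fin.castLE_injective hD h)
      refine abs_inner_le_of_projections
        (fun i => modeMul (c i) (U r (c i) * (U r (c i)).transpose))
        (fun i => modeMul (c i) (1 - U r (c i) * (U r (c i)).transpose))
        (fun i => modeMul (c i) (1 - U s (c i) * (U s (c i)).transpose))
        (fun i u v => inner_eq_add_of_transpose_mul_eq_zero (c i) (horth (c i) r s hrs) u v)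
        (fun i u => ?_) (fun i u => ?_) (fun i u => ?_)
        (fun i j hij u => modeMul_comm (hc i j hij) _ _ u)
        (fun i j hij => hp r _ _ (hc i j hij) (h1 r) (h2 r))
        (fun i j hij => hp s _ _ (hc i j hij) (h1 s) (h2 s))
      · obtain ⟨a, b, -, -⟩ := isProjection_of_transpose_mul_self_eq_one (hU r (c i))
        exact norm_modeMul_le a b u
      · obtain ⟨-, -, a, b⟩ := isProjection_of_transpose_mul_self_eq_one (hU r (c i))
        exact norm_modeMul_le a b u
      · obtain ⟨-, -, a, b⟩ := isProjection_of_transpose_mul_self_eq_one (hU s (c i))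
        exact norm_modeMul_le a b u
  refine (sq_le_sq₀ (by positivity) (norm_nonneg _)).1 ?_
  calc (η * ‖p.1 - p.2‖) ^ 2 = η ^ 2 * ‖p.1 - p.2‖ ^ 2 := mul_pow _ _ _
    _ ≤ (1 - 6 * ε * R ^ 2) * ‖p.1 - p.2‖ ^ 2 :=
        mul_le_mul_of_nonneg_right hεη (sq_nonneg _)
    _ ≤ _ := hge

end SBTD

/-! ### The condition number equals one -/

theorem mainTheorem8 {D R : ℕ} (hD : 1 ≤ D) (hR : 1 ≤ R) (hDR : 2 ≤ R → 3 ≤ D)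
    (n : Fin D → ℕ) (l : Fin R → Fin D → ℕ) (hl : ∀ r d, 1 ≤ l r d)
    (M : (r : Fin R) → Set (Tensor (l r))) (hM : ∀ r, IsTuckerCoreStructure (M r))
    (A : Fin R → Tensor n) (hA : IsSBTD M (∑ r, A r) A)
    (U : (r : Fin R) → (d : Fin D) → Matrix (Fin (n d)) (Fin (l r d)) ℝ)
    (C : (r : Fin R) → Tensor (l r)) (hUC : ∀ r, IsHOSVD (A r) (U r) (C r))
    (horth : ∀ d, ∀ r₁ r₂, r₁ ≠ r₂ → (U r₁ d).transpose * U r₂ d = 0) :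
    kappaSBTD M A = 1 := by
  refine le_antisymm ?_ ?_
  · have hle : ∀ η : ℝ, 0 < η → η < 1 → kappaSBTD M A ≤ ENNReal.ofReal η⁻¹ := fun η h0 h1 =>
      conditionNumber_le_of_lowerBound
        (P := {B : PiLp 2 fun _ : Fin R => Tensor n |
          ∀ r, B r ∈ structuredTuckerManifold (M r) n}) (a := WithLp.toLp 2 A) hA.1 h0
        (eventually_le_norm_sum_sub hDR (WithLp.toLp 2 A) U (fun r d => ((hUC r).2 d).1)
          (fun r => (hUC r).exists_unfolding_mul_eq) horth
          (fun r => structuredTuckerManifold (M r) n)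
          (fun r d B hB => unfoldingFactors_of_mem_structuredTuckerManifold hB d) h0.le h1)
    have hlim : Filter.Tendsto (fun η : ℝ => ENNReal.ofReal η⁻¹) (𝓝[<] 1) (𝓝 1) := by
      have : ContinuousAt (fun η : ℝ => ENNReal.ofReal η⁻¹) 1 :=
        ENNReal.continuous_ofReal.continuousAt.comp (continuousAt_inv₀ one_ne_zero)
      simpa using this.tendsto.mono_left nhdsWithin_le_nhds
    refine ge_of_tendsto hlim ?_
    filter_upwards [Ioo_mem_nhdsLT (zero_lt_one' ℝ)] with η hη using hle η hη.1 hη.2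
  · let d : Fin D := ⟨0, hD⟩
    let r : Fin R := ⟨0, hR⟩
    have hA0 : A r ≠ 0 := (hUC r).ne_zero d (hl r d)
    let t : ℕ → ℝ := fun k => 1 / ((k : ℝ) + 1)
    have ht : ∀ k, 0 < t k := fun k => Nat.one_div_pos_of_nat
    -- Replaces `A r` by `(1 + c) • A r`: the tuple and its sum both move by the norm of `c • A r`.
    let γ : ℝ → PiLp 2 fun _ : Fin R => Tensor n := fun c =>
      WithLp.toLp 2 A + PiLp.single 2 r (c • A r)
    have hsub : ∀ c, WithLp.toLp 2 A - γ c = -PiLp.single 2 r (c • A r) := fun c =>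
      sub_add_cancel_left _ _
    refine one_le_conditionNumber (fun k => γ (t k)) ?_ (fun k => ?_) (fun k h => ?_) (fun k => ?_)
    · have hc : Continuous γ :=
        continuous_const.add ((PiLp.continuous_toLp 2 _).comp
          ((continuous_single r).comp (continuous_id.smul continuous_const)))
      have h0 : γ 0 = WithLp.toLp 2 A := by simp [γ]
      exact h0 ▸ (hc.tendsto 0).comp tendsto_one_div_add_atTop_nhds_zero_nat
    · intro s
      rcases eq_or_ne s r with hs | hs
      · have h1 : γ (t k) s = (1 + t k) • A s := by
          subst hs; simp [γ, add_smul]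
        rw [h1]
        exact smul_mem_structuredTuckerManifold (hA.1 s) d (by linarith [ht k])
      · have h1 : γ (t k) s = A s := by simp [γ, hs]
        rw [h1]
        exact hA.1 s
    · have h0 := congrArg norm (hsub (t k))
      rw [h, sub_self, norm_neg, norm_zero, PiLp.norm_single, norm_smul] at h0
      exact mul_ne_zero (norm_ne_zero_iff.2 (ht k).ne') (norm_ne_zero_iff.2 hA0) h0.symm
    · rw [hsub, norm_neg, PiLp.norm_single]
      simp [γ, Finset.sum_add_distrib]
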